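/- Let $S$ be a finite set, let $M_1$ and $M_2$ be matroids with ground set $S$ that have at least one common base (a set $B \subseteq S$ that is a base of both matroids), and let $c : S \to \mathbb{R}$ be a cost function. For $B \subseteq S$ write $c(B) = \sum_{e \in B} c(e)$, and call a common base $B$ of $M_1$ and $M_2$ a minimum $c$-cost common base if $c(B) \le c(B')$ for every common base $B'$ of $M_1$ and $M_2$. Then there exist matroids $M_1'$ and $M_2'$ with ground set $S$ such that, for every $B \subseteq S$, the set $B$ is a common base of $M_1'$ and $M_2'$ if and only if it is a minimum $c$-cost common base of $M_1$ and $M_2$. -/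

import Mathlib

/-- `B` is a common base of the matroids `M₁` and `M₂`. -/
def IsCommonBase {α : Type*} (M₁ M₂ : Matroid α) (B : Set α) : Prop :=
  M₁.IsBase B ∧ M₂.IsBase B

/-- The cost `c(B) = ∑_{e ∈ B} c(e)` of a finite set `B`. -/
noncomputable def setCost {α : Type*} (c : α → ℝ) (B : Set α) : ℝ :=
  ∑ᶠ e ∈ B, c e

/-- `B` is a common base of `M₁` and `M₂` whose `c`-cost is minimum among all common bases
(for matroids whose ground sets are finite, so that all these costs are finite sums). -/
def IsMinCostCommonBase {α : Type*} (M₁ M₂ : Matroid α) (c : α → ℝ) (B : Set α) : Prop :=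
  IsCommonBase M₁ M₂ B ∧ ∀ B' : Set α, IsCommonBase M₁ M₂ B' → setCost c B ≤ setCost c B'

/-! Weight splitting: for a minimum cost common base `B₀`, write `c = c₁ + c₂` with `B₀` of minimum
`cᵢ`-cost in `Mᵢ`. A common base then has minimum `c`-cost iff it has minimum `cᵢ`-cost in both
`Mᵢ`, and by symmetric exchange the minimum cost bases of one matroid are again the bases of a
matroid. The splitting is read off a potential on the exchange digraph of `B₀`. The potential exists
because a negative closed walk with fewest arcs would give a cheaper common base: its chords are
acyclic enough for its exchanges to be made simultaneously in each matroid. -/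

theorem setCost_exchange {α : Type*} (c : α → ℝ) {B : Set α} (hB : B.Finite) {e f : α}
    (he : e ∈ B) (hf : f ∉ B) :
    setCost c (insert f (B \ {e})) = setCost c B - c e + c f := by
  unfold setCost
  rw [finsum_mem_insert _ (fun h => hf h.1) hB.sdiff]
  have h : insert e (B \ {e}) = B := by simp [he]
  have h2 := finsum_mem_insert c (a := e) (s := B \ {e}) (by simp) hB.sdiff
  rw [h] at h2
  rw [h2]
  ring

/-! ### Minimum cost bases of one matroid -/

/-- Symmetric exchange for the bases of a matroid. -/
theorem Matroid.IsBase.symm_exchange {α : Type*} {M : Matroid α} {B₁ B₂ : Set α} {e : α}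
    (h₁ : M.IsBase B₁) (h₂ : M.IsBase B₂) (he₁ : e ∈ B₁) (he₂ : e ∉ B₂) :
    ∃ f ∈ B₂, f ∉ B₁ ∧ M.IsBase (insert f (B₁ \ {e})) ∧ M.IsBase (insert e (B₂ \ {f})) := by
  have heE : e ∈ M.E := h₁.subset_ground he₁
  have hcl : e ∈ M.closure B₂ := by rwa [h₂.closure_eq]
  have hC := h₂.indep.fundCircuit_isCircuit hcl he₂
  have heC := M.mem_fundCircuit e B₂
  -- The circuit without `e` still spans `e`, which `B₁ \ {e}` does not.
  have hnot : ¬ M.fundCircuit e B₂ \ {e} ⊆ M.closure (B₁ \ {e}) := by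
    intro h
    have h3 := M.closure_subset_closure_of_subset_closure h
    exact h₁.indep.notMem_closure_sdiff_of_mem he₁ (h3 (hC.mem_closure_sdiff_singleton_of_mem heC))
  obtain ⟨f, ⟨hfC, hfe⟩, hf⟩ := Set.not_subset.1 hnot
  have hfe : f ≠ e := hfe
  have hf₂ : f ∈ B₂ := ((M.fundCircuit_subset_insert e B₂) hfC).resolve_left hfe
  have hf₁ : f ∉ B₁ := fun h => hf
    (M.subset_closure (B₁ \ {e}) (Set.sdiff_subset.trans h₁.subset_ground) ⟨h, hfe⟩)
  refine ⟨f, hf₂, hf₁, h₁.exchange_base_of_notMem_closure he₁ hf (h₂.subset_ground hf₂), ?_⟩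
  refine h₂.exchange_isBase_of_indep he₂ ?_
  have := (h₂.indep.mem_fundCircuit_iff hcl he₂).1 hfC
  rwa [← Set.insert_sdiff_singleton_comm hfe.symm] at this

/-- `B` is a base of `M` of minimum `c`-cost. -/
def Matroid.IsMinBase {α : Type*} (M : Matroid α) (c : α → ℝ) (B : Set α) : Prop :=
  M.IsBase B ∧ ∀ B', M.IsBase B' → setCost c B ≤ setCost c B'

/-- Minimality of `Y` under symmetric exchange gives `c f ≤ c a`, so the exchange in `X` does not
raise its cost. -/
theorem Matroid.IsMinBase.exchangeProperty {α : Type*} {M : Matroid α} (hE : M.E.Finite)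
    (c : α → ℝ) : Matroid.ExchangeProperty (M.IsMinBase c) := by
  rintro X Y ⟨hX, hXm⟩ ⟨hY, hYm⟩ a ⟨haX, haY⟩
  obtain ⟨f, hfY, hfX, h1, h2⟩ := hX.symm_exchange hY haX haY
  refine ⟨f, ⟨hfY, hfX⟩, h1, fun B' hB' => ?_⟩
  have e1 := setCost_exchange c (hE.subset hX.subset_ground) haX hfX
  have e2 := setCost_exchange c (hE.subset hY.subset_ground) hfY haY
  have := hYm _ h2
  have := hXm _ hB'
  linarith

/-- The matroid whose bases are the minimum `c`-cost bases of `M`. -/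
def Matroid.minBaseMatroid {α : Type*} (M : Matroid α) (hE : M.E.Finite) (c : α → ℝ)
    (h : ∃ B, M.IsMinBase c B) : Matroid α :=
  Matroid.ofIsBaseOfFinite hE (M.IsMinBase c) h (Matroid.IsMinBase.exchangeProperty hE c)
    (fun _ hB => hB.1.subset_ground)

/-- A base that no single exchange improves has minimum cost. -/
theorem Matroid.IsBase.isMinBase_of_exchange {α : Type*} {M : Matroid α} (hE : M.E.Finite)
    {c : α → ℝ} {B : Set α} (hB : M.IsBase B)
    (h : ∀ x ∈ B, ∀ y ∉ B, M.IsBase (insert y (B \ {x})) → c x ≤ c y) : M.IsMinBase c B := by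
  refine ⟨hB, ?_⟩
  suffices ∀ n : ℕ, ∀ B', M.IsBase B' → (B' \ B).ncard = n → setCost c B ≤ setCost c B' from
    fun B' hB' => this _ B' hB' rfl
  intro n
  induction n with
  | zero =>
    intro B' hB' hn
    rw [Set.ncard_eq_zero ((hE.subset hB'.subset_ground).sdiff), Set.sdiff_eq_empty] at hn
    rw [hB'.eq_of_subset_isBase hB hn]
  | succ n ih =>
    intro B' hB' hn
    have hfin := (hE.subset hB'.subset_ground).sdiff (t := B)
    obtain ⟨y, hy', hy⟩ := (Set.ncard_pos hfin).1 (by omega)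
    -- `h2` yields `c x ≤ c y`, so the base in `h1` is no dearer than `B'` and closer to `B`.
    obtain ⟨x, hx, hx', h1, h2⟩ := hB'.symm_exchange hB hy' hy
    have hlt : (insert x (B' \ {y})) \ B = (B' \ B) \ {y} := by
      ext z
      simp only [Set.mem_sdiff, Set.mem_insert_iff, Set.mem_singleton_iff]
      constructor
      · rintro ⟨rfl | h, h'⟩
        · exact absurd hx h'
        · exact ⟨⟨h.1, h'⟩, h.2⟩
      · rintro ⟨⟨h, h'⟩, h''⟩
        exact ⟨Or.inr ⟨h, h''⟩, h'⟩
    have := ih _ h1 (by rw [hlt, Set.ncard_sdiff_singleton_of_mem (show y ∈ B' \ B from ⟨hy', hy⟩), hn]; rfl)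
    rw [setCost_exchange c (hE.subset hB'.subset_ground) hy' hx'] at this
    have := h x hx y hy h2
    linarith

/-! ### Simultaneous exchanges -/

/-- Simultaneous exchanges `x i ↦ y i` in a base whose exchange graph is triangular with respect
to `Q` lead to a base. -/
theorem Matroid.IsBase.isBase_triangular_exchange {α ι : Type*} [DecidableEq ι] {M : Matroid α}
    {B : Set α} (hB : M.IsBase B) (x y : ι → α) (Q : ι → ℝ) (s : Finset ι)
    (hx : ∀ i ∈ s, x i ∈ B) (hy : ∀ i ∈ s, y i ∉ B)
    (hxy : ∀ i ∈ s, M.IsBase (insert (y i) (B \ {x i})))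
    (hQ : ∀ i ∈ s, ∀ j ∈ s, i ≠ j → M.IsBase (insert (y j) (B \ {x i})) → Q j < Q i) :
    M.IsBase ((B \ x '' s) ∪ y '' s) := by
  induction hn : s.card generalizing s with
  | zero =>
    rw [Finset.card_eq_zero] at hn
    simpa [hn] using hB
  | succ n ih =>
    -- The pair of least `Q` is exchanged last: every other `y j` lies in the closure of `B \ {x
    -- i}`, and `y i` does not.
    obtain ⟨i, hi, hmin⟩ := s.exists_min_image Q (Finset.card_pos.1 (by omega))
    have hs := ih (s.erase i) (fun j hj => hx j (Finset.mem_of_mem_erase hj))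
      (fun j hj => hy j (Finset.mem_of_mem_erase hj))
      (fun j hj => hxy j (Finset.mem_of_mem_erase hj))
      (fun j hj k hk => hQ j (Finset.mem_of_mem_erase hj) k (Finset.mem_of_mem_erase hk))
      (by rw [Finset.card_erase_of_mem hi, hn]; rfl)
    set B₁ := (B \ x '' (s.erase i)) ∪ y '' (s.erase i) with hB₁
    have hcl : B₁ \ {x i} ⊆ M.closure (B \ {x i}) := by
      rintro z ⟨hz | ⟨j, hj, rfl⟩, hzi⟩
      · exact M.subset_closure (B \ {x i}) (Set.sdiff_subset.trans hB.subset_ground) ⟨hz.1, hzi⟩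
      · have hj := Finset.mem_erase.1 (Finset.mem_coe.1 hj)
        by_contra hcon
        have hyE : y j ∈ M.E := (hxy j hj.2).subset_ground (Set.mem_insert _ _)
        have := hQ i hi j hj.2 hj.1.symm
          (hB.exchange_base_of_notMem_closure (hx i hi) hcon hyE)
        exact absurd (hmin j hj.2) (not_le.2 this)
    have hyi : y i ∉ M.closure (B \ {x i}) := by
      have h := (hxy i hi).indep.notMem_closure_sdiff_of_mem (Set.mem_insert _ _)
      rwa [Set.insert_sdiff_of_mem _ (Set.mem_singleton _),
        Set.sdiff_singleton_eq_self (fun h => hy i hi h.1)] at h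
    have hxi : x i ∈ B₁ := by
      refine Or.inl ⟨hx i hi, ?_⟩
      rintro ⟨j, hj, hij⟩
      have hj := Finset.mem_erase.1 (Finset.mem_coe.1 hj)
      have h1 := hQ i hi j hj.2 hj.1.symm (by rw [← hij]; exact hxy j hj.2)
      have h2 := hQ j hj.2 i hi hj.1 (by rw [hij]; exact hxy i hi)
      exact lt_asymm h1 h2
    have hfin := hs.exchange_base_of_notMem_closure hxi
      (fun h => hyi (M.closure_subset_closure_of_subset_closure hcl h))
      ((hxy i hi).subset_ground (Set.mem_insert _ _))
    convert hfin using 1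
    have hne : ∀ j ∈ s, y j ≠ x i := fun j hj h => hy j hj (h ▸ hx i hi)
    rw [← Finset.insert_erase hi, Finset.coe_insert, Set.image_insert_eq, Set.image_insert_eq, hB₁]
    ext z
    simp only [Set.mem_union, Set.mem_sdiff, Set.mem_insert_iff, Set.mem_singleton_iff]
    constructor
    · rintro (⟨h, h'⟩ | rfl | ⟨j, hj, rfl⟩)
      · exact Or.inr ⟨Or.inl ⟨h, fun h2 => h' (Or.inr h2)⟩, fun h2 => h' (Or.inl h2)⟩
      · exact Or.inl rfl
      · exact Or.inr ⟨Or.inr ⟨j, hj, rfl⟩, hne j (Finset.mem_of_mem_erase (Finset.mem_coe.1 hj))⟩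
    · rintro (rfl | ⟨⟨h, h'⟩ | h, h''⟩)
      · exact Or.inr (Or.inl rfl)
      · exact Or.inl ⟨h, fun h2 => h2.elim h'' h'⟩
      · exact Or.inr (Or.inr h)

/-! ### Closed walks and potentials -/

/-- If a digraph has no closed walk of negative weight, the weights of its walks are bounded
below. -/
theorem neg_sum_abs_le_sum_walk {α : Type*} [DecidableEq α] {S : Finset α} {R : α → α → Prop}
    {w : α → ℝ} (hR : ∀ u v, R u v → u ∈ S)
    (hc : ∀ (m : ℕ) (v : ℕ → α), (∀ t < m, R (v t) (v (t + 1))) → v m = v 0 →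
      0 ≤ ∑ t ∈ Finset.range m, w (v t)) (k : ℕ) (v : ℕ → α)
    (hv : ∀ t < k, R (v t) (v (t + 1))) :
    -∑ s ∈ S, |w s| ≤ ∑ t ∈ Finset.range k, w (v t) := by
  induction k using Nat.strong_induction_on generalizing v with
  | _ k ih =>
  by_cases hinj : Set.InjOn v (Finset.range k)
  · rw [← Finset.sum_image (f := w) hinj, neg_le]
    have hsub : (Finset.range k).image v ⊆ S := by
      intro z hz
      obtain ⟨t, ht, rfl⟩ := Finset.mem_image.1 hz
      exact hR _ _ (hv t (Finset.mem_range.1 ht))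
    calc -∑ s ∈ (Finset.range k).image v, w s
        ≤ |∑ s ∈ (Finset.range k).image v, w s| := neg_le_abs _
      _ ≤ ∑ s ∈ (Finset.range k).image v, |w s| := Finset.abs_sum_le_sum_abs _ _
      _ ≤ ∑ s ∈ S, |w s| :=
        Finset.sum_le_sum_of_subset_of_nonneg hsub fun _ _ _ => abs_nonneg _
  -- Cutting out the closed segment between two visits of a vertex shortens the walk and does not
  -- raise its weight.
  · obtain ⟨i, j, hij, hjk, he⟩ : ∃ i j, i < j ∧ j < k ∧ v i = v j := by
      simp only [Set.InjOn, not_forall] at hinj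
      obtain ⟨a, ha, b, hb, hab, hne⟩ := hinj
      simp only [Finset.coe_range, Set.mem_Iio] at ha hb
      rcases lt_or_gt_of_ne hne with h | h
      · exact ⟨a, b, h, hb, hab⟩
      · exact ⟨b, a, h, ha, hab.symm⟩
    obtain ⟨d, rfl⟩ := Nat.exists_eq_add_of_lt hij
    obtain ⟨l, rfl⟩ := Nat.exists_eq_add_of_lt hjk
    set d' := d + 1 with hd'
    have hseg := hc d' (fun t => v (i + t))
      (fun t ht => hv (i + t) (by omega)) (by simpa [hd', add_assoc] using he.symm)
    have hrest := ih (i + (l + 1)) (by omega) (fun t => if t ≤ i then v t else v (t + d')) (by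
      intro t ht
      rcases lt_trichotomy t i with h | rfl | h
      · simpa [h.le, Nat.succ_le_of_lt h] using hv t (by omega)
      · have := hv (t + d') (by omega)
        simp only [le_refl, if_true, show ¬ t + 1 ≤ t by omega, if_false]
        rw [he, show t + d + 1 = t + d' by omega, show t + 1 + d' = t + d' + 1 by omega]
        exact this
      · have := hv (t + d') (by omega)
        simp only [show ¬ t ≤ i by omega, show ¬ t + 1 ≤ i by omega, if_false]
        rwa [show t + 1 + d' = t + d' + 1 by omega])
    rw [show i + d + 1 + l + 1 = i + (d' + (l + 1)) by omega, Finset.sum_range_add,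
      Finset.sum_range_add]
    rw [Finset.sum_range_add] at hrest
    have e1 : ∑ t ∈ Finset.range i, w (if t ≤ i then v t else v (t + d'))
        = ∑ t ∈ Finset.range i, w (v t) :=
      Finset.sum_congr rfl fun t ht => by simp [(Finset.mem_range.1 ht).le]
    have e2 : ∑ t ∈ Finset.range (l + 1), w (if i + t ≤ i then v (i + t) else v (i + t + d'))
        = ∑ t ∈ Finset.range (l + 1), w (v (i + (d' + t))) := by
      refine Finset.sum_congr rfl fun t _ => ?_
      rcases Nat.eq_zero_or_pos t with rfl | h
      · simp only [add_zero, le_refl, if_true]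
        rw [he, show i + d + 1 = i + d' by omega]
      · simp only [show ¬ i + t ≤ i by omega, if_false]
        rw [show i + t + d' = i + (d' + t) by omega]
    rw [e1, e2] at hrest
    linarith

/-- A digraph without closed walks of negative weight has a feasible potential. -/
theorem exists_potential {α : Type*} {S : Set α} (hS : S.Finite) {R : α → α → Prop}
    {w : α → ℝ} (hR : ∀ u v, R u v → u ∈ S)
    (hc : ∀ (m : ℕ) (v : ℕ → α), (∀ t < m, R (v t) (v (t + 1))) → v m = v 0 →
      0 ≤ ∑ t ∈ Finset.range m, w (v t)) :
    ∃ p : α → ℝ, ∀ u v, R u v → p v ≤ p u + w u := by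
  classical
  -- Walks may start anywhere, so the empty walk makes every `W a` nonempty.
  let W : α → Set ℝ := fun a => {r | ∃ (k : ℕ) (v : ℕ → α), (∀ t < k, R (v t) (v (t + 1))) ∧
    v k = a ∧ r = ∑ t ∈ Finset.range k, w (v t)}
  have hbdd : ∀ a, BddBelow (W a) := fun a => by
    refine ⟨-∑ s ∈ hS.toFinset, |w s|, ?_⟩
    rintro _ ⟨k, v, hv, -, rfl⟩
    exact neg_sum_abs_le_sum_walk (fun u v h => by simpa using hR u v h) hc k v hv
  have hne : ∀ a, (W a).Nonempty := fun a => ⟨0, 0, fun _ => a, by simp⟩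
  refine ⟨fun a => sInf (W a), fun u v huv => ?_⟩
  rw [← sub_le_iff_le_add]
  refine le_csInf (hne u) ?_
  rintro _ ⟨k, x, hx, rfl, rfl⟩
  rw [sub_le_iff_le_add]
  refine csInf_le (hbdd v) ⟨k + 1, fun t => if t ≤ k then x t else v, ?_, by simp, ?_⟩
  · intro t ht
    rcases (Nat.lt_succ_iff.1 ht).lt_or_eq with h | rfl
    · simpa [h.le, Nat.succ_le_of_lt h] using hx t h
    · simpa using huv
  · rw [Finset.sum_range_succ]
    simp only [le_refl, if_true]
    congr 1
    exact Finset.sum_congr rfl fun t ht => by simp [(Finset.mem_range.1 ht).le]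

/-- A shortest closed walk of negative weight, continued periodically. Its chords decrease the
function `Q`. -/
theorem exists_chord_decreasing_walk {α : Type*} {R : α → α → Prop} {w : α → ℝ}
    (h : ∃ (m : ℕ) (v : ℕ → α), (∀ t < m, R (v t) (v (t + 1))) ∧ v m = v 0 ∧
      ∑ t ∈ Finset.range m, w (v t) < 0) :
    ∃ (m : ℕ) (u : ℕ → α) (Q : ℕ → ℝ), 0 < m ∧ (∀ t, u (t + m) = u t) ∧
      (∀ t, R (u t) (u (t + 1))) ∧ ∑ t ∈ Finset.range m, w (u t) < 0 ∧
      ∀ i < m, ∀ k < m, i ≠ k → R (u i) (u (k + 1)) → Q k < Q i := by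
  classical
  let m := Nat.find h
  obtain ⟨v, hv, hvm, hneg⟩ := Nat.find_spec h
  change ∀ t < m, _ at hv
  change v m = _ at hvm
  change ∑ t ∈ Finset.range m, w (v t) < 0 at hneg
  have hmin : ∀ (l : ℕ) (x : ℕ → α), l < m → (∀ t < l, R (x t) (x (t + 1))) → x l = x 0 →
      0 ≤ ∑ t ∈ Finset.range l, w (x t) := fun l x hl hx hx0 => by
    by_contra hcon
    exact Nat.find_min h hl ⟨x, hx, hx0, not_le.1 hcon⟩
  have hm : 0 < m := by
    rcases Nat.eq_zero_or_pos m with h0 | h0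
    · rw [h0] at hneg; simp at hneg
    · exact h0
  clear_value m
  let u : ℕ → α := fun t => v (t % m)
  have hper : ∀ t, u (t + m) = u t := fun t => by simp [u]
  have hu : ∀ t < m, u t = v t := fun t ht => by simp [u, Nat.mod_eq_of_lt ht]
  have hsum : ∑ t ∈ Finset.range m, w (u t) = ∑ t ∈ Finset.range m, w (v t) :=
    Finset.sum_congr rfl fun t ht => by rw [hu t (Finset.mem_range.1 ht)]
  have hRu : ∀ t, R (u t) (u (t + 1)) := fun t => by
    have hlt := Nat.mod_lt t hm
    have h1 := hv (t % m) hlt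
    have h2 : u (t + 1) = v (t % m + 1) := by
      change v ((t + 1) % m) = _
      rw [← Nat.mod_add_mod]
      rcases Nat.lt_or_ge (t % m + 1) m with h | h
      · rw [Nat.mod_eq_of_lt h]
      · rw [show t % m + 1 = m by omega, Nat.mod_self, hvm]
    rw [h2]
    exact h1
  have hchord : ∀ j l, l + 1 < m → R (u (j + l)) (u j) →
      0 ≤ ∑ t ∈ Finset.range (l + 1), w (u (j + t)) := fun j l hl hR => by
    have := hmin (l + 1) (fun t => if t ≤ l then u (j + t) else u j) hl (by
      intro t ht
      rcases (Nat.lt_succ_iff.1 ht).lt_or_eq with h | rfl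
      · simpa [h.le, Nat.succ_le_of_lt h, add_assoc] using hRu (j + t)
      · simpa using hR) (by simp)
    refine this.trans_eq (Finset.sum_congr rfl fun t ht => ?_)
    simp [Nat.lt_succ_iff.1 (Finset.mem_range.1 ht)]
  set W := ∑ t ∈ Finset.range m, w (u t) with hW
  have hWneg : W < 0 := by rw [hsum]; exact hneg
  -- Subtracting the mean weight makes `q` periodic. As the mean is negative, `q` strictly increases
  -- over any segment of nonnegative weight.
  let q : ℕ → ℝ := fun k => ∑ t ∈ Finset.range k, w (u t) - k * (W / m)
  have hm' : (m : ℝ) ≠ 0 := by exact_mod_cast hm.ne'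
  have hWm : W / m < 0 := div_neg_of_neg_of_pos hWneg (by exact_mod_cast hm)
  have hq : ∀ j l, q (j + (l + 1)) - q j =
      ∑ t ∈ Finset.range (l + 1), w (u (j + t)) - (l + 1) * (W / m) := fun j l => by
    simp only [q]
    rw [Finset.sum_range_add]
    push_cast
    ring
  have hqper : ∀ k, q (k + m) = q k := fun k => by
    simp only [q]
    rw [add_comm k m, Finset.sum_range_add, ← hW]
    have : ∑ t ∈ Finset.range k, w (u (m + t)) = ∑ t ∈ Finset.range k, w (u t) :=
      Finset.sum_congr rfl fun t _ => by rw [add_comm, hper]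
    rw [this]
    push_cast
    field_simp
    ring
  have hlt : ∀ j l, l + 1 < m → R (u (j + l)) (u j) → q j < q (j + (l + 1)) := fun j l hl hR => by
    have h1 := hchord j l hl hR
    have h2 := hq j l
    have h3 : ((l : ℝ) + 1) * (W / m) < 0 := mul_neg_of_pos_of_neg (by positivity) hWm
    linarith
  -- A chord from `u i` to `u (k + 1)` closes the segment from `k + 1` to `i`, around the period if
  -- `i < k`; hence the shift.
  refine ⟨m, u, fun k => q (k + 1), hm, hper, hRu, hWneg, fun i hi k hk hik hR => ?_⟩
  rcases lt_or_gt_of_ne hik with h | h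
  · have := hlt (k + 1) (i + m - (k + 1)) (by omega) (by
      rw [show k + 1 + (i + m - (k + 1)) = i + m by omega, hper]; exact hR)
    rwa [show k + 1 + (i + m - (k + 1) + 1) = i + 1 + m by omega, hqper] at this
  · have := hlt (k + 1) (i - (k + 1)) (by omega) (by
      rw [show k + 1 + (i - (k + 1)) = i by omega]; exact hR)
    rwa [show k + 1 + (i - (k + 1) + 1) = i + 1 by omega] at this

/-! ### The exchange digraph and weight splitting -/

/-- The arcs of the exchange digraph of a common base `B` of `M₁` and `M₂`. -/
def ExchangeArc {α : Type*} (M₁ M₂ : Matroid α) (B : Set α) (u v : α) : Prop :=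
  (u ∈ B ∧ v ∉ B ∧ M₁.IsBase (insert v (B \ {u}))) ∨
    (u ∉ B ∧ v ∈ B ∧ M₂.IsBase (insert u (B \ {v})))

/-- The index shift permutes a period. This identifies the sets exchanged in `M₁` with those
exchanged in `M₂`. -/
theorem Function.Periodic.image_succ_filter {α : Type*} {m : ℕ} (hm : 0 < m) {u : ℕ → α}
    (hu : Function.Periodic u m) {p q : α → Prop} [DecidablePred p] [DecidablePred q]
    (hpq : ∀ i, p (u i) ↔ q (u (i + 1))) :
    (fun i => u (i + 1)) '' ((Finset.range m).filter fun i => p (u i) : Finset ℕ) =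
      u '' ((Finset.range m).filter fun i => q (u i) : Finset ℕ) := by
  ext z
  simp only [Set.mem_image, Finset.coe_filter, Finset.mem_range, Set.mem_ofPred_eq]
  constructor
  · rintro ⟨i, ⟨-, hi⟩, rfl⟩
    have h := hu.map_mod_nat (i + 1)
    exact ⟨(i + 1) % m, ⟨Nat.mod_lt _ hm, by rw [h]; exact (hpq i).1 hi⟩, h⟩
  · rintro ⟨k, ⟨hk, hq⟩, rfl⟩
    have h : u ((k + m - 1) % m + 1) = u k := by
      rcases Nat.eq_zero_or_pos k with rfl | h0
      · rw [Nat.mod_eq_of_lt (by omega), show 0 + m - 1 + 1 = 0 + m by omega, hu]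
      · rw [show k + m - 1 = k - 1 + m by omega, Nat.add_mod_right, Nat.mod_eq_of_lt (by omega),
          Nat.sub_add_cancel h0]
    exact ⟨(k + m - 1) % m, ⟨Nat.mod_lt _ hm, by rw [hpq, h]; exact hq⟩, h⟩

theorem setCost_sdiff_union {α : Type*} (c : α → ℝ) {B : Set α} (hB : B.Finite) {X Y : Finset α}
    (hX : (X : Set α) ⊆ B) (hY : Disjoint B (Y : Set α)) :
    setCost c ((B \ X) ∪ Y) = setCost c B - ∑ e ∈ X, c e + ∑ e ∈ Y, c e := by
  unfold setCost
  rw [finsum_mem_union (hY.mono_left Set.sdiff_subset) hB.sdiff Y.finite_toSet,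
    finsum_mem_coe_finset]
  have h := finsum_mem_union (f := c) (Set.disjoint_sdiff_left (s := (X : Set α)) (t := B)) hB.sdiff
    X.finite_toSet
  rw [Set.sdiff_union_of_subset hX, finsum_mem_coe_finset] at h
  rw [h]
  ring

open Classical in
/-- The exchange digraph of a minimum cost common base has no closed walk of negative weight. -/
theorem IsMinCostCommonBase.sum_closed_walk_nonneg {α : Type*} {M₁ M₂ : Matroid α} {c : α → ℝ}
    {B : Set α} (hB : IsMinCostCommonBase M₁ M₂ c B) (hfin : B.Finite) (m : ℕ) (v : ℕ → α)
    (hv : ∀ t < m, ExchangeArc M₁ M₂ B (v t) (v (t + 1))) (hvm : v m = v 0) :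
    0 ≤ ∑ t ∈ Finset.range m, (if v t ∈ B then -c (v t) else c (v t)) := by
  by_contra hcon
  obtain ⟨m, u, Q, hm, hper, hR, hneg, hQ⟩ :=
    exists_chord_decreasing_walk (w := fun a => if a ∈ B then -c a else c a)
      ⟨m, v, hv, hvm, not_le.1 hcon⟩
  clear hcon hv hvm v
  have halt : ∀ i, u i ∈ B ↔ u (i + 1) ∉ B := fun i => by
    rcases hR i with ⟨h1, h2, -⟩ | ⟨h1, h2, -⟩ <;> simp [h1, h2]
  have hinj : Set.InjOn u (Finset.range m) := by
    intro i hi k hk hik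
    by_contra hne
    simp only [Finset.coe_range, Set.mem_Iio] at hi hk
    have h1 := hQ i hi k hk hne (by rw [hik]; exact hR k)
    have h2 := hQ k hk i hi (Ne.symm hne) (by rw [← hik]; exact hR i)
    exact lt_asymm h1 h2
  have him₁ := Function.Periodic.image_succ_filter hm (u := u) hper
    (p := fun a => a ∈ B) (q := fun a => a ∉ B) halt
  have him₂ := Function.Periodic.image_succ_filter hm (u := u) hper
    (p := fun a => a ∉ B) (q := fun a => a ∈ B) (fun i => by rw [halt i, not_not])
  set I := (Finset.range m).filter fun i => u i ∈ B with hI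
  set J := (Finset.range m).filter fun i => u i ∉ B with hJ
  have mI : ∀ i ∈ I, i < m ∧ u i ∈ B := fun i hi => by simpa [hI] using hi
  have mJ : ∀ i ∈ J, i < m ∧ u i ∉ B := fun i hi => by simpa [hJ] using hi
  have b₁ := hB.1.1.isBase_triangular_exchange u (fun i => u (i + 1)) Q I
    (fun i hi => (mI i hi).2) (fun i hi => (halt i).1 (mI i hi).2)
    (fun i hi => by
      rcases hR i with ⟨-, -, h⟩ | ⟨h, -⟩
      · exact h
      · exact absurd (mI i hi).2 h)
    (fun i hi j hj hij h => hQ i (mI i hi).1 j (mI j hj).1 hij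
      (Or.inl ⟨(mI i hi).2, (halt j).1 (mI j hj).2, h⟩))
  have hJs : ∀ i ∈ J, u (i + 1) ∈ B := fun i hi => by
    by_contra h
    exact (mJ i hi).2 ((halt i).2 h)
  -- Arcs of `M₂` enter `B`, so heads and tails swap roles and `Q` changes sign.
  have b₂ := hB.1.2.isBase_triangular_exchange (fun i => u (i + 1)) u (fun i => -Q i) J
    hJs (fun i hi => (mJ i hi).2)
    (fun i hi => by
      rcases hR i with ⟨h, -⟩ | ⟨-, -, h⟩
      · exact absurd h (mJ i hi).2
      · exact h)
    (fun i hi j hj hij h => neg_lt_neg (hQ j (mJ j hj).1 i (mJ i hi).1 hij.symm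
      (Or.inr ⟨(mJ j hj).2, hJs i hi, h⟩)))
  rw [him₁] at b₁
  rw [him₂] at b₂
  have hle := hB.2 _ ⟨b₁, b₂⟩
  have hIsub : (I : Set ℕ) ⊆ Finset.range m := Finset.coe_subset.2 (Finset.filter_subset _ _)
  have hJsub : (J : Set ℕ) ⊆ Finset.range m := Finset.coe_subset.2 (Finset.filter_subset _ _)
  rw [← Finset.coe_image, ← Finset.coe_image, setCost_sdiff_union c hfin,
    Finset.sum_image (hinj.mono hIsub), Finset.sum_image (hinj.mono hJsub)] at hle
  · rw [← Finset.sum_filter_add_sum_filter_not _ (fun i => u i ∈ B), ← hI, ← hJ,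
      Finset.sum_congr rfl (g := fun i => -c (u i)) (fun i hi => if_pos (mI i hi).2),
      Finset.sum_congr (s₁ := J) rfl (g := fun i => c (u i)) (fun i hi => if_neg (mJ i hi).2),
      Finset.sum_neg_distrib] at hneg
    linarith
  · intro z hz
    obtain ⟨i, hi, rfl⟩ := Finset.mem_image.1 (Finset.mem_coe.1 hz)
    exact (mI i hi).2
  · rw [Set.disjoint_right]
    intro z hz
    obtain ⟨i, hi, rfl⟩ := Finset.mem_image.1 (Finset.mem_coe.1 hz)
    exact (mJ i hi).2

/-- Weight splitting: the cost function splits so that a given minimum cost common base is a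
minimum cost base of both matroids. -/
theorem IsMinCostCommonBase.exists_weight_splitting {α : Type*} {M₁ M₂ : Matroid α} {c : α → ℝ}
    {B : Set α} (hE₁ : M₁.E.Finite) (hE₂ : M₂.E.Finite) (hB : IsMinCostCommonBase M₁ M₂ c B) :
    ∃ c₁ c₂ : α → ℝ, (∀ e, c e = c₁ e + c₂ e) ∧ M₁.IsMinBase c₁ B ∧ M₂.IsMinBase c₂ B := by
  classical
  have hfin := hE₁.subset hB.1.1.subset_ground
  obtain ⟨p, hp⟩ := exists_potential (S := M₁.E ∪ M₂.E) (hE₁.union hE₂)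
    (R := ExchangeArc M₁ M₂ B) (w := fun a => if a ∈ B then -c a else c a)
    (by
      rintro u v (⟨h, -, -⟩ | ⟨-, -, h⟩)
      · exact Or.inl (hB.1.1.subset_ground h)
      · exact Or.inr (h.subset_ground (Set.mem_insert _ _)))
    (hB.sum_closed_walk_nonneg hfin)
  -- With this choice the potential inequality on an arc says that the exchange does not improve `B`
  -- in its matroid.
  refine ⟨fun e => if e ∈ B then c e - p e else -p e, fun e => if e ∈ B then p e else c e + p e,
    fun e => by dsimp only; split_ifs <;> ring, ?_, ?_⟩
  · refine hB.1.1.isMinBase_of_exchange hE₁ fun x hx y hy h => ?_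
    have := hp x y (Or.inl ⟨hx, hy, h⟩)
    simp only [hx, hy, if_true, if_false] at this ⊢
    linarith
  · refine hB.1.2.isMinBase_of_exchange hE₂ fun x hx y hy h => ?_
    have := hp y x (Or.inr ⟨hy, hx, h⟩)
    simp only [hx, hy, if_true, if_false] at this ⊢
    linarith

theorem mainTheorem5 {α : Type*} (S : Set α) (hS : S.Finite)
    (M₁ M₂ : Matroid α) (hM₁ : M₁.E = S) (hM₂ : M₂.E = S)
    (c : α → ℝ) (hcommon : ∃ B : Set α, IsCommonBase M₁ M₂ B) :
    ∃ M₁' M₂' : Matroid α, M₁'.E = S ∧ M₂'.E = S ∧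
      ∀ B : Set α, IsCommonBase M₁' M₂' B ↔ IsMinCostCommonBase M₁ M₂ c B := by
  have hE₁ : M₁.E.Finite := hM₁ ▸ hS
  have hE₂ : M₂.E.Finite := hM₂ ▸ hS
  have hbases : {B | IsCommonBase M₁ M₂ B}.Finite :=
    hE₁.finite_subsets.subset fun B hB => hB.1.subset_ground
  obtain ⟨B₀, hB₀, hmin⟩ := Set.exists_min_image _ (setCost c) hbases hcommon
  have hB₀ : IsMinCostCommonBase M₁ M₂ c B₀ := ⟨hB₀, hmin⟩
  obtain ⟨c₁, c₂, hc, h₁, h₂⟩ := hB₀.exists_weight_splitting hE₁ hE₂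
  have hadd : ∀ B, M₁.IsBase B → setCost c B = setCost c₁ B + setCost c₂ B := fun B hB => by
    unfold setCost
    rw [← finsum_mem_add_distrib (hE₁.subset hB.subset_ground)]
    simp only [hc]
  refine ⟨M₁.minBaseMatroid hE₁ c₁ ⟨B₀, h₁⟩, M₂.minBaseMatroid hE₂ c₂ ⟨B₀, h₂⟩, hM₁, hM₂,
    fun B => ?_⟩
  change M₁.IsMinBase c₁ B ∧ M₂.IsMinBase c₂ B ↔ _
  have e₀ := hadd B₀ h₁.1
  constructor
  · rintro ⟨hB₁, hB₂⟩
    refine ⟨⟨hB₁.1, hB₂.1⟩, fun B' hB' => ?_⟩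
    rw [hadd B hB₁.1, hadd B' hB'.1]
    exact add_le_add (hB₁.2 B' hB'.1) (hB₂.2 B' hB'.2)
  · rintro ⟨⟨hB₁, hB₂⟩, hBm⟩
    have e := hadd B hB₁
    -- Together with `l₁` and `l₂` this forces `B` and `B₀` to have equal `c₁`-cost and equal
    -- `c₂`-cost.
    have hle := hBm B₀ hB₀.1
    have l₁ := h₁.2 B hB₁
    have l₂ := h₂.2 B hB₂
    refine ⟨⟨hB₁, fun B' hB' => ?_⟩, ⟨hB₂, fun B' hB' => ?_⟩⟩
    · have := h₁.2 B' hB'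
      linarith
    · have := h₂.2 B' hB'
      linarith
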